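/- Let $\alpha,\beta,a,b>0$, $\gamma\ge 0$ and $\lambda\in\mathbb R$, and let $B\in\mathbb C[X]$ be a polynomial with $B(0)=0$. Let $C_u(\mathbb R)$ be the Banach space of bounded uniformly continuous functions $\mathbb R\to\mathbb C$ with the supremum norm, and let $$A_\lambda(\mathbb R)=\Big\{u\in C_u(\mathbb R):\ u(x)=\sum_{j=1}^\infty a_je^{ij\lambda x}\ (x\in\mathbb R)\ \text{ for some } a_j\in\mathbb C \text{ with } \sum_{j=1}^\infty|a_j|<\infty\Big\}.$$ Consider the complex Ginzburg--Landau equation $$\partial_tu=(\alpha+i\beta)\,\partial_{xx}u+\gamma u+(a+ib)\,B(u),\qquad u(0)=u_0. \tag{CGL}$$ Let $U(0)=\mathrm{Id}$ and, for $t>0$, $U(t)v=G_t*v$ with $$G_t(x)=(4\pi t(\alpha+i\beta))^{-1/2}\exp\Big(-\frac{x^2}{4t(\alpha+i\beta)}+\gamma t\Big)$$ (principal branch of the square root). For an interval $J\subseteq[0,\infty)$ with left end point $0\in J$, a mild solution of (CGL) on $J$ is a function $u\in C(J,C_u(\mathbb R))$ such that $$u(t)=U(t)u_0+\int_0^tU(t-s)\big[(a+ib)B(u(s))\big]\,ds\qquad\text{for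 all } t\in J,$$ and $T^*(u_0)\in[0,\infty]$ denotes the supremum of all $T\ge0$ for which a mild solution on $[0,T]$ exists. Theorem. If $u_0\in A_\lambda(\mathbb R)$, then $T^*(u_0)>0$, there is a unique mild solution $u$ of (CGL) on $[0,T^*(u_0))$, and $u(t)\in A_\lambda(\mathbb R)$ for every $t\in(0,T^*(u_0))$. -/

import Mathlib

open MeasureTheory Filter Topology
open scoped BoundedContinuousFunction

noncomputable section

/-- `C_u(ℝ)`: the bounded uniformly continuous functions `ℝ → ℂ` with the supremum norm
(inherited from the bounded continuous functions) and pointwise operations. -/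
def Cu : Subalgebra ℂ (ℝ →ᵇ ℂ) where
  carrier := {f | UniformContinuous f}
  mul_mem' := by
    intro f g hf hg
    have hK : UniformContinuousOn (fun p : ℂ × ℂ => p.1 * p.2)
        (Metric.closedBall 0 ‖f‖ ×ˢ Metric.closedBall 0 ‖g‖) :=
      ((isCompact_closedBall _ _).prod (isCompact_closedBall _ _)).uniformContinuousOn_of_continuous
        continuous_mul.continuousOn
    have hfg : UniformContinuous (fun x : ℝ => (f x, g x)) := UniformContinuous.prodMk hf hg
    have hmem : Set.MapsTo (fun x : ℝ => (f x, g x)) Set.univ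
        (Metric.closedBall 0 ‖f‖ ×ˢ Metric.closedBall 0 ‖g‖) := by
      intro x _
      exact ⟨by simpa using f.norm_coe_le_norm x, by simpa using g.norm_coe_le_norm x⟩
    have h := hK.comp (uniformContinuousOn_univ.2 hfg) hmem
    exact uniformContinuousOn_univ.1 h
  add_mem' := by
    intro f g hf hg
    exact UniformContinuous.add hf hg
  algebraMap_mem' := by
    intro r
    exact uniformContinuous_const

theorem Cu_isClosed : IsClosed (Cu : Set (ℝ →ᵇ ℂ)) := by
  refine isClosed_of_closure_subset fun f hf => ?_
  refine Metric.uniformContinuous_iff.2 fun ε hε => ?_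
  obtain ⟨g, hg, hfg⟩ := Metric.mem_closure_iff.1 hf (ε / 3) (by positivity)
  obtain ⟨δ, hδ, h⟩ := Metric.uniformContinuous_iff.1 (show UniformContinuous g from hg) (ε / 3)
    (by positivity)
  refine ⟨δ, hδ, fun {x y} hxy => ?_⟩
  have h1 := (BoundedContinuousFunction.dist_coe_le_dist (f := f) (g := g) x).trans_lt hfg
  have h2 := (BoundedContinuousFunction.dist_coe_le_dist (f := f) (g := g) y).trans_lt hfg
  have h3 := h hxy
  have h4 := dist_triangle4 (f x) (g x) (g y) (f y)
  rw [dist_comm (g y)] at h4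
  linarith

instance Cu.instCompleteSpace : CompleteSpace Cu := Cu_isClosed.completeSpace_coe

/-- `A_λ(ℝ)`: the functions `∑_{j ≥ 1} a_j e^{i j λ x}` with `∑_{j ≥ 1} |a_j| < ∞`
(the coefficient with index `j + 1` is stored as `a j`). -/
def ALambda (lam : ℝ) : Set Cu :=
  {u | ∃ a : ℕ → ℂ, Summable (fun j => ‖a j‖) ∧
    ∀ x : ℝ, HasSum (fun j : ℕ => a j * Complex.exp (Complex.I * ((j + 1 : ℕ) : ℂ) * lam * x))
      (u.1 x)}

/-- The kernel `G_t(x) = (4 π t (α + i β))^{-1/2} exp (- x² / (4 t (α + i β)) + γ t)`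
(principal branch of the root), for `t > 0`. -/
def cglKernel (α β γ t x : ℝ) : ℂ :=
  (4 * Real.pi * t * (α + β * Complex.I) : ℂ) ^ (-(1 / 2) : ℂ) *
    Complex.exp (-(x : ℂ) ^ 2 / (4 * t * (α + β * Complex.I)) + γ * t)

theorem cglKernel_integrable {α : ℝ} (hα : 0 < α) (β γ : ℝ) {t : ℝ} (ht : 0 < t) :
    Integrable (cglKernel α β γ t) := by
  set c : ℂ := 4 * t * (α + β * Complex.I) with hc
  have hcre : 0 < c.re := by simp [hc]; positivity
  have hb : 0 < (c⁻¹).re := by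
    rw [Complex.inv_re]
    exact div_pos hcre (Complex.normSq_pos.2 fun h => by simp [h] at hcre)
  have h := ((integrable_cexp_neg_mul_sq hb).mul_const (Complex.exp (γ * t))).const_mul
    ((4 * Real.pi * t * (α + β * Complex.I) : ℂ) ^ (-(1 / 2) : ℂ))
  refine h.congr (Filter.Eventually.of_forall fun x => ?_)
  simp only [cglKernel]
  rw [← Complex.exp_add]
  congr 2
  rw [← hc]
  ring

theorem cglKernel_mul_integrable {α : ℝ} (hα : 0 < α) (β γ : ℝ) {t : ℝ} (ht : 0 < t) (u : Cu)
    (x : ℝ) : Integrable (fun y => cglKernel α β γ t y * u.1 (x - y)) :=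
  (cglKernel_integrable hα β γ ht).mul_bdd (c := ‖u.1‖)
    ((u.1.continuous.comp (continuous_const.sub continuous_id)).aestronglyMeasurable)
    (Filter.Eventually.of_forall fun y => u.1.norm_coe_le_norm (x - y))

theorem cglConv_uniformContinuous {α : ℝ} (hα : 0 < α) (β γ : ℝ) {t : ℝ} (ht : 0 < t) (u : Cu) :
    UniformContinuous (fun x : ℝ => ∫ y, cglKernel α β γ t y * u.1 (x - y)) := by
  set K : ℝ := ∫ y, ‖cglKernel α β γ t y‖ with hK
  have hK0 : 0 ≤ K := integral_nonneg fun y => norm_nonneg _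
  refine Metric.uniformContinuous_iff.2 fun ε hε => ?_
  obtain ⟨δ, hδ, h⟩ := Metric.uniformContinuous_iff.1 (show UniformContinuous u.1 from u.2)
    (ε / (K + 1)) (by positivity)
  refine ⟨δ, hδ, fun {x x'} hx => ?_⟩
  rw [dist_eq_norm, ← integral_sub (cglKernel_mul_integrable hα β γ ht u x)
    (cglKernel_mul_integrable hα β γ ht u x')]
  have hle : ‖∫ y, (cglKernel α β γ t y * u.1 (x - y) - cglKernel α β γ t y * u.1 (x' - y))‖
      ≤ ∫ y, ‖cglKernel α β γ t y‖ * (ε / (K + 1)) := by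
    refine norm_integral_le_of_norm_le
      ((cglKernel_integrable hα β γ ht).norm.mul_const _) (Filter.Eventually.of_forall fun y => ?_)
    rw [← mul_sub, norm_mul]
    refine mul_le_mul_of_nonneg_left ?_ (norm_nonneg _)
    rw [← dist_eq_norm]
    exact (h (by simpa [Real.dist_eq] using hx)).le
  refine hle.trans_lt ?_
  rw [integral_mul_const, ← hK, mul_div_assoc', div_lt_iff₀ (by positivity)]
  nlinarith

theorem cglConv_norm_le {α : ℝ} (β γ : ℝ) (hα : 0 < α) {t : ℝ} (ht : 0 < t) (u : Cu) (x : ℝ) :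
    ‖∫ y, cglKernel α β γ t y * u.1 (x - y)‖ ≤ (∫ y, ‖cglKernel α β γ t y‖) * ‖u.1‖ := by
  rw [← integral_mul_const]
  refine norm_integral_le_of_norm_le
    ((cglKernel_integrable hα β γ ht).norm.mul_const _) (Filter.Eventually.of_forall fun y => ?_)
  rw [norm_mul]
  exact mul_le_mul_of_nonneg_left (u.1.norm_coe_le_norm _) (norm_nonneg _)

/-- The semigroup `U(t)` on `C_u(ℝ)` of `∂_t u = (α + i β) ∂_{xx} u + γ u`: the convolution
`U(t) u = G_t * u` for `t > 0`, and `U(0) u = u`. (Only `t ≥ 0` is meaningful.) -/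
def cglSemigroup {α : ℝ} (hα : 0 < α) (β γ t : ℝ) (u : Cu) : Cu :=
  if ht : 0 < t then
    ⟨BoundedContinuousFunction.ofNormedAddCommGroup
      (fun x : ℝ => ∫ y, cglKernel α β γ t y * u.1 (x - y))
      (cglConv_uniformContinuous hα β γ ht u).continuous
      ((∫ y, ‖cglKernel α β γ t y‖) * ‖u.1‖)
      (cglConv_norm_le β γ hα ht u),
     cglConv_uniformContinuous hα β γ ht u⟩
  else u

/-- `u ∈ C(J, C_u(ℝ))` is a mild solution on the time interval `J` (with left end point `0`) of
`∂_t u = (α + i β) u_xx + γ u + (a + i b) B(u)`, `u(0) = u₀`: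
`u(t) = U(t) u₀ + ∫_0^t U(t - s) ((a + i b) B(u(s))) ds` for all `t ∈ J`,
with a Bochner integral in the Banach space `C_u(ℝ)`. -/
structure IsMildSolution {α : ℝ} (hα : 0 < α) (β γ a b : ℝ) (B : Polynomial ℂ) (u₀ : Cu)
    (J : Set ℝ) (u : ℝ → Cu) : Prop where
  continuousOn : ContinuousOn u J
  eq_duhamel : ∀ t ∈ J, u t = cglSemigroup hα β γ t u₀ +
    ∫ s in (0 : ℝ)..t, cglSemigroup hα β γ (t - s)
      (((a : ℂ) + b * Complex.I) • Polynomial.aeval (u s) B)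

/-- The maximal existence time `T*(u₀) ∈ [0, ∞]`: the supremum of all `T ≥ 0` such that a mild
solution in `C([0, T], C_u(ℝ))` exists. -/
def maxTime {α : ℝ} (hα : 0 < α) (β γ a b : ℝ) (B : Polynomial ℂ) (u₀ : Cu) : EReal :=
  sSup {τ : EReal | ∃ T : ℝ, 0 ≤ T ∧ τ = (T : EReal) ∧
    ∃ u : ℝ → Cu, IsMildSolution hα β γ a b B u₀ (Set.Icc 0 T) u}

/-- The half-open time interval `[0, T*(u₀))`. -/
def maxInterval {α : ℝ} (hα : 0 < α) (β γ a b : ℝ) (B : Polynomial ℂ) (u₀ : Cu) : Set ℝ :=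
  {t : ℝ | 0 ≤ t ∧ (t : EReal) < maxTime hα β γ a b B u₀}

end

/-!
The equation is treated as the fixed point problem `u = S(·) u₀ + ∫₀^· S(· - s) N(u(s)) ds` in the
Banach space `C_u(ℝ)`, where `N(f) = (a + ib) B(f)` is Lipschitz on balls and `S` is the semigroup.
Writing `S(t) f` as an average of translates `f(· - √t z)` (`heatFlow`) shows that it is a bounded
operator depending strongly continuously on `t ≥ 0`; this uses the uniform continuity of `f`. So the
contraction principle gives local existence (`exists_duhamel_solution`), hence `T* > 0`, Gronwall's
inequality gives uniqueness (`duhamel_unique`), and the solutions on the intervals `[0, T]` glue to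
one on `[0, T*)`.

For membership in `A_λ` no a priori estimate of the `A_λ` norm is needed. Let `X` be the closed span
in `C_u(ℝ)` of the waves `e^{ijλx}`, `j ≥ 1` (`waveSpace`). It contains `A_λ`; it is invariant under
`S(t)`, because the waves are eigenfunctions; and it is invariant under `N`, because it is closed
under products and `B(0) = 0`. The distance `d(t)` of `u(t)` to `X` satisfies `d(t) ≤ K ∫₀ᵗ d`, so
`u` stays in `X` (`duhamel_mem`). This requires neither the semigroup law nor a continuation argument.

It remains to see that the Fourier coefficients of `u(t) ∈ X` are summable for `t > 0`, which is
parabolic smoothing (`norm_waveCoeff_duhamel_le`): with `κ_j = α j² λ²`, the `j`-th coefficient of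
`S(t) u₀` is `O(e^{-κ_j t})`, and that of the integral is `O(∫₀ᵗ e^{-κ_j (t - s)} ds) = O(1 / κ_j)`,
since the coefficients of `N(u(s))` are at most its supremum norm, which is bounded on `[0, t]`.
An element of `X` with summable coefficients is the sum of its Fourier series
(`mem_ALambda_of_summable_waveCoeff`). For `λ = 0` both `X` and `A_λ` are the constants.
-/

noncomputable section

/-! ### Semilinear integral equations in a Banach space -/

/-- Gronwall's inequality in integral form, without a source term. -/
theorem eq_zero_of_le_mul_integral {e : ℝ → ℝ} (he : Continuous e) (he0 : ∀ t, 0 ≤ e t)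
    {K T : ℝ} (h : ∀ t ∈ Set.Icc 0 T, e t ≤ K * ∫ s in (0 : ℝ)..t, e s) :
    ∀ t ∈ Set.Icc 0 T, e t = 0 := by
  have hd : ∀ t, HasDerivAt (fun t => ∫ s in (0 : ℝ)..t, e s) (e t) t := fun t =>
    intervalIntegral.integral_hasDerivAt_right (he.intervalIntegrable _ _)
      (he.stronglyMeasurableAtFilter _ _) he.continuousAt
  have hnn : ∀ t ∈ Set.Icc 0 T, 0 ≤ ∫ s in (0 : ℝ)..t, e s := fun t ht =>
    intervalIntegral.integral_nonneg ht.1 fun s _ => he0 s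
  have key := norm_le_gronwallBound_of_norm_deriv_right_le (δ := 0) (K := K) (ε := 0)
    (a := 0) (b := T) (fun t _ => (hd t).continuousAt.continuousWithinAt)
    (fun t _ => (hd t).hasDerivWithinAt) (by simp) (fun t ht => by
      have ht' := Set.Ico_subset_Icc_self ht
      rw [Real.norm_of_nonneg (he0 t), Real.norm_of_nonneg (hnn t ht'), add_zero]
      exact h t ht')
  intro t ht
  have h0 : ∫ s in (0 : ℝ)..t, e s = 0 := by
    have := key t ht
    rw [gronwallBound_ε0_δ0] at this
    exact norm_le_zero_iff.1 this
  have := h t ht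
  rw [h0, mul_zero] at this
  exact le_antisymm this (he0 t)

section Semilinear

variable {E : Type*} [NormedAddCommGroup E]

/-- Lipschitz continuity on every ball about the origin. In infinite dimensions this is stronger
than being Lipschitz near each point. -/
def LipschitzOnBalls (N : E → E) : Prop :=
  ∀ R : ℝ, ∃ L : ℝ, 0 ≤ L ∧ ∀ f g, ‖f‖ ≤ R → ‖g‖ ≤ R → ‖N f - N g‖ ≤ L * ‖f - g‖

theorem LipschitzOnBalls.continuous {N : E → E} (hN : LipschitzOnBalls N) : Continuous N := by
  refine continuous_iff_continuousAt.2 fun f => ?_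
  obtain ⟨L, hL, h⟩ := hN (‖f‖ + 1)
  have hball : LipschitzOnWith L.toNNReal N (Metric.ball f 1) := by
    refine LipschitzOnWith.of_dist_le_mul fun x hx y hy => ?_
    rw [dist_eq_norm, dist_eq_norm, Real.coe_toNNReal _ hL]
    have hb : ∀ z ∈ Metric.ball f 1, ‖z‖ ≤ ‖f‖ + 1 := fun z hz => by
      have h1 : ‖z - f‖ < 1 := by simpa [dist_eq_norm] using hz
      have h2 := norm_add_le f (z - f)
      rw [add_sub_cancel] at h2
      linarith
    exact h x y (hb x hx) (hb y hy)
  exact hball.continuousOn.continuousAt (Metric.ball_mem_nhds f one_pos)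

theorem exists_continuous_eqOn_Icc {T : ℝ} (hT : 0 ≤ T) {u : ℝ → E}
    (hu : ContinuousOn u (Set.Icc 0 T)) :
    ∃ v : ℝ → E, Continuous v ∧ Set.EqOn v u (Set.Icc 0 T) ∧ ∃ R, ∀ t, ‖v t‖ ≤ R := by
  obtain ⟨R, hR⟩ := isCompact_Icc.exists_bound_of_continuousOn hu
  exact ⟨Set.IccExtend hT ((Set.Icc 0 T).domRestrict u), hu.domRestrict.Icc_extend',
    fun t ht => Set.IccExtend_of_mem _ _ ht, R, fun t => hR _ (Set.projIcc 0 T hT t).2⟩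

variable [NormedSpace ℝ E]

/-- The right-hand side `S(t) u₀ + ∫₀ᵗ S(t - s) N(u(s)) ds` of the variation of constants
formula. -/
def duhamel (S : ℝ → E →L[ℝ] E) (N : E → E) (u₀ : E) (u : ℝ → E) (t : ℝ) : E :=
  S t u₀ + ∫ s in (0 : ℝ)..t, S (t - s) (N (u s))

variable {S : ℝ → E →L[ℝ] E} {N : E → E} {u₀ : E}

theorem duhamel_congr {T : ℝ} {u v : ℝ → E} (h : Set.EqOn u v (Set.Icc 0 T)) {t : ℝ}
    (ht : t ∈ Set.Icc 0 T) : duhamel S N u₀ u t = duhamel S N u₀ v t := by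
  unfold duhamel
  congr 1
  refine intervalIntegral.integral_congr fun s hs => ?_
  rw [Set.uIcc_of_le ht.1] at hs
  simp only [h ⟨hs.1, hs.2.trans ht.2⟩]

theorem continuous_duhamel_integrand (hS : Continuous fun p : ℝ × E => S p.1 p.2)
    (hN : Continuous N) {u : ℝ → E} (hu : Continuous u) :
    Continuous fun p : ℝ × ℝ => S (p.1 - p.2) (N (u p.2)) :=
  hS.comp ((continuous_fst.sub continuous_snd).prodMk (hN.comp (hu.comp continuous_snd)))

theorem intervalIntegrable_duhamel_integrand (hS : Continuous fun p : ℝ × E => S p.1 p.2)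
    (hN : Continuous N) {u : ℝ → E} (hu : Continuous u) (t : ℝ) :
    IntervalIntegrable (fun s => S (t - s) (N (u s))) volume 0 t :=
  ((continuous_duhamel_integrand hS hN hu).comp
    (continuous_const.prodMk continuous_id)).intervalIntegrable _ _

theorem continuous_duhamel (hS : Continuous fun p : ℝ × E => S p.1 p.2) (hN : Continuous N)
    {u : ℝ → E} (hu : Continuous u) : Continuous (duhamel S N u₀ u) :=
  (hS.comp (continuous_id.prodMk continuous_const)).add
    (intervalIntegral.continuous_parametric_intervalIntegral_of_continuous
      (f := fun t s => S (t - s) (N (u s))) (continuous_duhamel_integrand hS hN hu)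
      continuous_id)

theorem duhamel_unique (hS : Continuous fun p : ℝ × E => S p.1 p.2)
    (hN : LipschitzOnBalls N) {T C : ℝ} (hC : ∀ t ∈ Set.Icc 0 T, ‖S t‖ ≤ C)
    {u v : ℝ → E} (hu : ContinuousOn u (Set.Icc 0 T)) (hv : ContinuousOn v (Set.Icc 0 T))
    (hu' : ∀ t ∈ Set.Icc 0 T, u t = duhamel S N u₀ u t)
    (hv' : ∀ t ∈ Set.Icc 0 T, v t = duhamel S N u₀ v t) :
    Set.EqOn u v (Set.Icc 0 T) := by
  rcases lt_or_ge T 0 with hT | hT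
  · simp [Set.Icc_eq_empty hT.not_ge]
  obtain ⟨u', hu'c, hu'e, R₁, hR₁⟩ := exists_continuous_eqOn_Icc hT hu
  obtain ⟨v', hv'c, hv'e, R₂, hR₂⟩ := exists_continuous_eqOn_Icc hT hv
  obtain ⟨L, hL, hLN⟩ := hN (max R₁ R₂)
  have hC0 : 0 ≤ C := (norm_nonneg _).trans (hC 0 ⟨le_rfl, hT⟩)
  have key := eq_zero_of_le_mul_integral (e := fun t => ‖u' t - v' t‖) (K := C * L) (T := T)
    (hu'c.sub hv'c).norm (fun _ => norm_nonneg _) (fun t ht => by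
      have e1 : u' t = duhamel S N u₀ u' t := by
        rw [hu'e ht, hu' t ht, duhamel_congr hu'e ht]
      have e2 : v' t = duhamel S N u₀ v' t := by
        rw [hv'e ht, hv' t ht, duhamel_congr hv'e ht]
      rw [e1, e2, duhamel, duhamel, add_sub_add_left_eq_sub,
        ← intervalIntegral.integral_sub
          (intervalIntegrable_duhamel_integrand hS hN.continuous hu'c t)
          (intervalIntegrable_duhamel_integrand hS hN.continuous hv'c t),
        ← intervalIntegral.integral_const_mul]
      refine intervalIntegral.norm_integral_le_of_norm_le ht.1
        (Eventually.of_forall fun s hs => ?_)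
        ((continuous_const.mul (hu'c.sub hv'c).norm).intervalIntegrable _ _)
      rw [← map_sub, mul_assoc]
      refine (ContinuousLinearMap.le_opNorm _ _).trans (mul_le_mul
        (hC _ ⟨sub_nonneg.2 hs.2, by linarith [hs.1, ht.2]⟩) (hLN _ _
          ((hR₁ s).trans (le_max_left _ _)) ((hR₂ s).trans (le_max_right _ _)))
          (norm_nonneg _) hC0))
  intro t ht
  have := key t ht
  rwa [norm_eq_zero, sub_eq_zero, hu'e ht, hv'e ht] at this

/-- A mild solution stays in a closed subspace `X` that contains the initial value and is invariant
under the linear flow and the nonlinearity: the distance to `X`, which is the norm of the class in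
`E ⧸ X`, satisfies a linear integral inequality with zero initial value. -/
theorem duhamel_mem [CompleteSpace E] (hS : Continuous fun p : ℝ × E => S p.1 p.2)
    (hN : LipschitzOnBalls N) {T C : ℝ} (hC : ∀ t ∈ Set.Icc 0 T, ‖S t‖ ≤ C)
    (X : Submodule ℝ E) (hX : IsClosed (X : Set E)) (hSX : ∀ t, ∀ f ∈ X, S t f ∈ X)
    (hNX : ∀ f ∈ X, N f ∈ X) (hu₀ : u₀ ∈ X)
    {u : ℝ → E} (hu : ContinuousOn u (Set.Icc 0 T))
    (hu' : ∀ t ∈ Set.Icc 0 T, u t = duhamel S N u₀ u t) :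
    ∀ t ∈ Set.Icc 0 T, u t ∈ X := by
  rcases lt_or_ge T 0 with hT | hT
  · simp [Set.Icc_eq_empty hT.not_ge]
  have : IsClosed (X : Set E) := hX
  obtain ⟨v, hvc, hve, R, hR⟩ := exists_continuous_eqOn_Icc hT hu
  have hR0 : 0 ≤ R := (norm_nonneg _).trans (hR 0)
  obtain ⟨L, hL, hLN⟩ := hN (2 * R + 1)
  have hC0 : 0 ≤ C := (norm_nonneg _).trans (hC 0 ⟨le_rfl, hT⟩)
  let q : E →L[ℝ] E ⧸ X := X.mkQL
  have hq0 : ∀ f ∈ X, q f = 0 := fun f hf => (Submodule.Quotient.mk_eq_zero X).2 hf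
  have hqn : ∀ f, ‖q f‖ ≤ ‖f‖ := fun f => Submodule.Quotient.norm_mk_le X f
  have hstep : ∀ r ∈ Set.Icc 0 T, ∀ f, ‖f‖ ≤ R → ‖q (S r (N f))‖ ≤ C * L * ‖q f‖ := by
    intro r hr f hf
    have hqf : ‖q f‖ ≤ R := (hqn f).trans hf
    -- replace `f` by a nearly minimal representative `m` of its class; then `f - m ∈ X`
    have hε : ∀ ε > 0, ε ≤ 1 → ‖q (S r (N f))‖ ≤ C * L * (‖q f‖ + ε) := by
      intro ε hε hε1
      obtain ⟨m, hm, hmn⟩ := Submodule.Quotient.norm_mk_lt (S := X) (q f) hε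
      have hw : f - m ∈ X := by
        rw [← Submodule.Quotient.mk_eq_zero X, Submodule.Quotient.mk_sub, hm]
        exact sub_self _
      have hwn : ‖f - m‖ ≤ 2 * R + 1 := (norm_sub_le _ _).trans (by linarith)
      have e : q (S r (N f)) = q (S r (N f - N (f - m))) := by
        rw [map_sub, map_sub, hq0 _ (hSX r _ (hNX _ hw)), sub_zero]
      rw [e, mul_assoc]
      refine (hqn _).trans ((ContinuousLinearMap.le_opNorm _ _).trans (mul_le_mul (hC r hr) ?_
        (norm_nonneg _) hC0))
      refine (hLN f (f - m) (by linarith) hwn).trans ?_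
      rw [sub_sub_cancel]
      exact mul_le_mul_of_nonneg_left hmn.le hL
    refine ge_of_tendsto (x := 𝓝[>] (0 : ℝ)) (f := fun ε => C * L * (‖q f‖ + ε)) ?_ ?_
    · have : Continuous fun ε : ℝ => C * L * (‖q f‖ + ε) := by fun_prop
      simpa using (this.tendsto 0).mono_left nhdsWithin_le_nhds
    · filter_upwards [Ioc_mem_nhdsGT (zero_lt_one (α := ℝ))] with ε h using hε ε h.1 h.2
  have key := eq_zero_of_le_mul_integral (e := fun t => ‖q (v t)‖) (K := C * L) (T := T)
    (q.continuous.comp hvc).norm (fun _ => norm_nonneg _) (fun t ht => by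
      have e1 : v t = duhamel S N u₀ v t := by
        rw [hve ht, hu' t ht, duhamel_congr hve ht]
      rw [e1, duhamel, map_add, hq0 _ (hSX t _ hu₀), zero_add,
        ← ContinuousLinearMap.intervalIntegral_comp_comm _
          (intervalIntegrable_duhamel_integrand hS hN.continuous hvc t),
        ← intervalIntegral.integral_const_mul]
      refine intervalIntegral.norm_integral_le_of_norm_le ht.1
        (Eventually.of_forall fun s hs => ?_)
        ((continuous_const.mul (q.continuous.comp hvc).norm).intervalIntegrable _ _)
      exact hstep _ ⟨sub_nonneg.2 hs.2, by linarith [hs.1, ht.2]⟩ _ (hR s))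
  intro t ht
  have h0 := norm_eq_zero.1 (key t ht)
  rw [hve ht] at h0
  exact (Submodule.Quotient.mk_eq_zero X).1 h0

/-- Local existence: on a short interval the Duhamel map is a contraction of a closed ball of
`C([0, T], E)`. -/
theorem exists_duhamel_solution [CompleteSpace E]
    (hS : Continuous fun p : ℝ × E => S p.1 p.2)
    (hN : LipschitzOnBalls N) {C : ℝ} (hC : ∀ t ∈ Set.Icc (0 : ℝ) 1, ‖S t‖ ≤ C) :
    ∃ T > 0, ∃ u : ℝ → E, ContinuousOn u (Set.Icc 0 T) ∧
      ∀ t ∈ Set.Icc 0 T, u t = duhamel S N u₀ u t := by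
  have hC0 : 0 ≤ C := (norm_nonneg _).trans (hC 0 (by simp))
  set R : ℝ := C * ‖u₀‖ + 1 with hR
  have hR0 : 0 ≤ R := by positivity
  obtain ⟨L, hL, hLN⟩ := hN R
  set M : ℝ := ‖N 0‖ + L * R with hM
  have hM0 : 0 ≤ M := by positivity
  have hNM : ∀ f, ‖f‖ ≤ R → ‖N f‖ ≤ M := fun f hf => by
    have h1 := hLN f 0 hf (by simpa using hR0)
    have h2 := norm_add_le (N 0) (N f - N 0)
    rw [add_sub_cancel] at h2
    rw [sub_zero] at h1
    have h3 := mul_le_mul_of_nonneg_left hf hL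
    linarith
  set T : ℝ := 1 / (2 * (1 + C * M + C * L)) with hTdef
  have hden : 0 < 1 + C * M + C * L := by positivity
  have hT : 0 < T := by positivity
  have hT1 : T ≤ 1 := by
    rw [hTdef, div_le_one (by positivity)]
    nlinarith [mul_nonneg hC0 hM0, mul_nonneg hC0 hL]
  have hTh : T * (1 + C * M + C * L) = 1 / 2 := by
    rw [hTdef]; field_simp
  have hTM : C * M * T ≤ 1 := by nlinarith [mul_nonneg hC0 hM0, mul_nonneg hC0 hL]
  have hTL : C * L * T ≤ 1 / 2 := by nlinarith [mul_nonneg hC0 hM0, mul_nonneg hC0 hL]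
  let ext : C(Set.Icc (0 : ℝ) T, E) → ℝ → E := fun w => Set.IccExtend hT.le w
  have hext : ∀ w, Continuous (ext w) := fun w => w.continuous.Icc_extend'
  have hextn : ∀ w s, ‖ext w s‖ ≤ ‖w‖ := fun w s => w.norm_coe_le_norm _
  let Φ : C(Set.Icc (0 : ℝ) T, E) → C(Set.Icc (0 : ℝ) T, E) := fun w =>
    ⟨fun t => duhamel S N u₀ (ext w) t,
      (continuous_duhamel hS hN.continuous (hext w)).comp continuous_subtype_val⟩
  have hSC : ∀ t ∈ Set.Icc 0 T, ∀ s ∈ Set.uIoc 0 t, ‖S (t - s)‖ ≤ C := fun t ht s hs => by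
    rw [Set.uIoc_of_le ht.1] at hs
    exact hC _ ⟨sub_nonneg.2 hs.2, by linarith [hs.1, ht.2]⟩
  let s : Set C(Set.Icc (0 : ℝ) T, E) := Metric.closedBall 0 R
  have hs : IsComplete s := Metric.isClosed_closedBall.isComplete
  have hmaps : Set.MapsTo Φ s s := by
    intro w hw
    have hw' : ‖w‖ ≤ R := by simpa [s] using hw
    suffices ‖Φ w‖ ≤ R by simpa [s] using this
    refine (ContinuousMap.norm_le _ hR0).2 fun t => ?_
    have h1 : ‖S t u₀‖ ≤ C * ‖u₀‖ := (ContinuousLinearMap.le_opNorm _ _).trans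
      (mul_le_mul_of_nonneg_right (hC _ ⟨t.2.1, t.2.2.trans hT1⟩) (norm_nonneg _))
    have h2 : ‖∫ r in (0 : ℝ)..t, S (t - r) (N (ext w r))‖ ≤ C * M * |(t : ℝ) - 0| :=
      intervalIntegral.norm_integral_le_of_norm_le_const fun r hr =>
        (ContinuousLinearMap.le_opNorm _ _).trans (mul_le_mul (hSC t t.2 r hr)
          (hNM _ ((hextn w r).trans hw')) (norm_nonneg _) hC0)
    have h3 : C * M * |(t : ℝ) - 0| ≤ C * M * T := by
      rw [sub_zero, abs_of_nonneg t.2.1]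
      exact mul_le_mul_of_nonneg_left t.2.2 (mul_nonneg hC0 hM0)
    exact (norm_add_le _ _).trans (by linarith)
  have hcontr : ContractingWith (1 / 2) (hmaps.restrict Φ s s) := by
    refine ⟨by rw [← NNReal.coe_lt_coe]; norm_num, LipschitzWith.of_dist_le_mul ?_⟩
    rintro ⟨w, hw⟩ ⟨z, hz⟩
    have hw' : ‖w‖ ≤ R := by simpa [s] using hw
    have hz' : ‖z‖ ≤ R := by simpa [s] using hz
    change dist (Φ w) (Φ z) ≤ _ * dist w z
    rw [dist_eq_norm, dist_eq_norm]
    have hhalf : (((1 / 2 : NNReal)) : ℝ) = 1 / 2 := by norm_num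
    rw [hhalf]
    refine (ContinuousMap.norm_le _ (by positivity)).2 fun t => ?_
    change ‖duhamel S N u₀ (ext w) t - duhamel S N u₀ (ext z) t‖ ≤ _
    rw [duhamel, duhamel, add_sub_add_left_eq_sub, ← intervalIntegral.integral_sub
      (intervalIntegrable_duhamel_integrand hS hN.continuous (hext w) t)
      (intervalIntegrable_duhamel_integrand hS hN.continuous (hext z) t)]
    have h2 : ‖∫ r in (0 : ℝ)..t, (S (t - r) (N (ext w r)) - S (t - r) (N (ext z r)))‖
        ≤ C * (L * ‖w - z‖) * |(t : ℝ) - 0| := by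
      refine intervalIntegral.norm_integral_le_of_norm_le_const fun r hr => ?_
      rw [← map_sub]
      refine (ContinuousLinearMap.le_opNorm _ _).trans (mul_le_mul (hSC t t.2 r hr) ?_
        (norm_nonneg _) hC0)
      refine (hLN _ _ ((hextn w r).trans hw') ((hextn z r).trans hz')).trans ?_
      exact mul_le_mul_of_nonneg_left ((w - z).norm_coe_le_norm _) hL
    refine h2.trans ?_
    rw [sub_zero, abs_of_nonneg t.2.1]
    have h4 : C * (L * ‖w - z‖) * t ≤ C * (L * ‖w - z‖) * T :=
      mul_le_mul_of_nonneg_left t.2.2 (by positivity)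
    nlinarith [norm_nonneg (w - z)]
  obtain ⟨w, -, hw, -⟩ := hcontr.exists_fixedPoint' hs hmaps
    (x := 0) (by simpa [s] using hR0) (edist_ne_top _ _)
  refine ⟨T, hT, ext w, (hext w).continuousOn, fun t ht => ?_⟩
  have h1 : ext w t = w ⟨t, ht⟩ := Set.IccExtend_of_mem _ _ ht
  have h2 := DFunLike.congr_fun hw ⟨t, ht⟩
  rw [h1]
  exact h2.symm

end Semilinear

/-! ### The complex heat semigroup on `C_u(ℝ)` -/

theorem continuous_cglKernel (α β γ t : ℝ) : Continuous (cglKernel α β γ t) := by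
  unfold cglKernel
  fun_prop

/-- The Fourier transform of the kernel at time `1`. -/
theorem integral_cglKernel_mul_exp {α : ℝ} (hα : 0 < α) (β η : ℝ) :
    ∫ z, cglKernel α β 0 1 z * Complex.exp (Complex.I * η * z) =
      Complex.exp (-((α + β * Complex.I) * η ^ 2)) := by
  set c : ℂ := α + β * Complex.I with hc
  have hcre : 0 < c.re := by simp [hc, hα]
  have hc0 : c ≠ 0 := fun h => by simp [h] at hcre
  have hb : 0 < ((4 * c)⁻¹).re := by
    rw [Complex.inv_re]
    refine div_pos (by simpa using hcre) (Complex.normSq_pos.2 (by simpa using hc0))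
  have hπ : (4 * Real.pi * c : ℂ) ≠ 0 := by
    simp [hc0, Real.pi_ne_zero]
  have h := fourierIntegral_gaussian hb (η : ℂ)
  have e : ∀ z : ℝ, cglKernel α β 0 1 z * Complex.exp (Complex.I * η * z) =
      (4 * Real.pi * c : ℂ) ^ (-(1 / 2) : ℂ) *
        (Complex.exp (Complex.I * η * z) * Complex.exp (-(4 * c)⁻¹ * (z : ℂ) ^ 2)) := by
    intro z
    rw [cglKernel, ← hc]
    have e1 : (-(z : ℂ) ^ 2 / (4 * (1 : ℝ) * c) + (0 : ℝ) * (1 : ℝ)) = -(4 * c)⁻¹ * (z : ℂ) ^ 2 := by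
      push_cast
      field_simp
      ring
    rw [e1]
    push_cast
    ring_nf
  have e2 : (Real.pi / (4 * c)⁻¹ : ℂ) = 4 * Real.pi * c := by
    rw [div_inv_eq_mul]; ring
  have e3 : (-(η : ℂ) ^ 2 / (4 * (4 * c)⁻¹)) = -(c * η ^ 2) := by
    field_simp
  simp_rw [e]
  rw [integral_const_mul, h, e2, e3, ← mul_assoc, ← Complex.cpow_add _ _ hπ]
  norm_num

theorem integral_cglKernel_one {α : ℝ} (hα : 0 < α) (β : ℝ) : ∫ z, cglKernel α β 0 1 z = 1 := by
  simpa using integral_cglKernel_mul_exp hα β 0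

/-- Parabolic scaling of the kernel. -/
theorem sqrt_mul_cglKernel {α : ℝ} (hα : 0 < α) (β γ : ℝ) {t : ℝ} (ht : 0 < t) (z : ℝ) :
    (√t : ℂ) * cglKernel α β γ t (√t * z) = Complex.exp (γ * t) * cglKernel α β 0 1 z := by
  rw [cglKernel, cglKernel]
  set c : ℂ := α + β * Complex.I with hc
  have hcre : 0 < c.re := by simp [hc, hα]
  have hc0 : c ≠ 0 := fun h => by simp [h] at hcre
  have ht0 : (t : ℂ) ≠ 0 := by exact_mod_cast ht.ne'
  have hπ : (4 * Real.pi * c : ℂ) ≠ 0 := by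
    simp [hc0, Real.pi_ne_zero]
  have hsq : (√t : ℂ) ^ 2 = t := by
    rw [← Complex.ofReal_pow, Real.sq_sqrt ht.le]
  have e1 : (4 * Real.pi * t * c : ℂ) ^ (-(1 / 2) : ℂ) =
      (t : ℂ) ^ (-(1 / 2) : ℂ) * (4 * Real.pi * c : ℂ) ^ (-(1 / 2) : ℂ) := by
    have : (4 * Real.pi * t * c : ℂ) = t * (4 * Real.pi * c) := by ring
    rw [this, Complex.cpow_def_of_ne_zero (mul_ne_zero ht0 hπ), Complex.log_ofReal_mul ht hπ,
      Complex.cpow_def_of_ne_zero ht0, Complex.cpow_def_of_ne_zero hπ, ← Complex.exp_add,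
      Complex.ofReal_log ht.le, add_mul]
  have e2 : (√t : ℂ) * (t : ℂ) ^ (-(1 / 2) : ℂ) = 1 := by
    rw [Real.sqrt_eq_rpow, Complex.ofReal_cpow ht.le, ← Complex.cpow_add _ _ ht0]
    norm_num
  have e3 : (-((√t * z : ℝ) : ℂ) ^ 2 / (4 * t * c) + γ * t) =
      γ * t + (-(z : ℂ) ^ 2 / (4 * (1 : ℝ) * c) + (0 : ℝ) * (1 : ℝ)) := by
    push_cast
    rw [mul_pow, hsq]
    field_simp
    ring
  rw [e1, e3, Complex.exp_add, ← mul_assoc, ← mul_assoc (√t : ℂ), e2, one_mul, Complex.ofReal_one]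
  simp only [mul_one]
  ring

namespace Cu

/-- The translation `f(· - h)` of a bounded uniformly continuous function. -/
def translate (h : ℝ) (f : Cu) : Cu :=
  ⟨f.1.compContinuous ⟨fun x => x - h, by fun_prop⟩,
    (show UniformContinuous f.1 from f.2).comp (uniformContinuous_id.sub uniformContinuous_const)⟩

theorem norm_translate_le (h : ℝ) (f : Cu) : ‖translate h f‖ ≤ ‖f‖ :=
  (BoundedContinuousFunction.norm_le (norm_nonneg _)).2 fun x => f.1.norm_coe_le_norm (x - h)

/-- Uniform continuity of `f` is continuity of its orbit under translations. -/
theorem continuous_translate (f : Cu) : Continuous fun h => translate h f := by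
  refine Metric.continuous_iff.2 fun h ε hε => ?_
  obtain ⟨δ, hδ, H⟩ := Metric.uniformContinuous_iff.1 (show UniformContinuous f.1 from f.2)
    (ε / 2) (by positivity)
  refine ⟨δ, hδ, fun k hk => lt_of_le_of_lt ?_ (half_lt_self hε)⟩
  refine (BoundedContinuousFunction.dist_le (half_pos hε).le).2 fun x => (H ?_).le
  change dist (x - k) (x - h) < δ
  rwa [dist_sub_left]

/-- Evaluation at a point as a continuous linear functional. -/
def evalL (x : ℝ) : Cu →L[ℂ] ℂ :=
  (BoundedContinuousFunction.evalCLM ℂ x).comp (Subalgebra.toSubmodule Cu).subtypeL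

@[simp]
theorem evalL_apply (x : ℝ) (f : Cu) : evalL x f = f.1 x := rfl

/-- The wave `x ↦ e^{iξx}`. -/
def wave (ξ : ℝ) : Cu :=
  ⟨BoundedContinuousFunction.ofNormedAddCommGroup (fun x : ℝ => Complex.exp (Complex.I * ξ * x))
    (by fun_prop) 1 fun x => by
      rw [mul_assoc, ← Complex.ofReal_mul, mul_comm, Complex.norm_exp_ofReal_mul_I], by
    have hL : LipschitzWith (‖ξ‖₊) fun x : ℝ => Complex.exp (Complex.I * ξ * x) := by
      refine LipschitzWith.of_dist_le_mul fun x y => ?_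
      have e : Complex.exp (Complex.I * ξ * x) - Complex.exp (Complex.I * ξ * y) =
          Complex.exp ((ξ * y : ℝ) * Complex.I) *
            (Complex.exp (Complex.I * (ξ * (x - y) : ℝ)) - 1) := by
        rw [mul_sub, ← Complex.exp_add, mul_one]
        push_cast
        ring_nf
      rw [dist_eq_norm, e, norm_mul, Complex.norm_exp_ofReal_mul_I, one_mul, dist_eq_norm,
        coe_nnnorm, ← norm_mul]
      exact Real.norm_exp_I_mul_ofReal_sub_one_le
    exact hL.uniformContinuous⟩

@[simp]
theorem wave_apply (ξ x : ℝ) : (wave ξ).1 x = Complex.exp (Complex.I * ξ * x) := rfl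

theorem norm_wave_le (ξ : ℝ) : ‖wave ξ‖ ≤ 1 :=
  (BoundedContinuousFunction.norm_le zero_le_one).2 fun x => by
    change ‖Complex.exp (Complex.I * ξ * x)‖ ≤ 1
    rw [mul_assoc, ← Complex.ofReal_mul, mul_comm, Complex.norm_exp_ofReal_mul_I]

instance instSecondCountableTopologyEither : SecondCountableTopologyEither ℝ Cu :=
  secondCountableTopologyEither_of_left ℝ Cu

theorem ext_apply {f g : Cu} (h : ∀ x, f.1 x = g.1 x) : f = g :=
  Subtype.ext (BoundedContinuousFunction.ext h)

end Cu

theorem cglKernel_smul_translate_integrable {α : ℝ} (hα : 0 < α) (β r : ℝ) (f : Cu) :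
    Integrable fun z => cglKernel α β 0 1 z • Cu.translate (r * z) f := by
  refine ((cglKernel_integrable hα β 0 one_pos).norm.mul_const ‖f‖).mono'
    ((continuous_cglKernel α β 0 1).smul
      ((Cu.continuous_translate f).comp (continuous_const.mul continuous_id))).aestronglyMeasurable
    (Eventually.of_forall fun z => ?_)
  rw [norm_smul]
  exact mul_le_mul_of_nonneg_left (Cu.norm_translate_le _ _) (norm_nonneg _)

/-- The semigroup `U(t)` as a family of bounded operators, written by parabolic scaling as an
average of translations, `U(t) f = e^{γt} ∫ G₁(z) f(· - √t z) dz` with the kernel `G₁` of `γ = 0`.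
This form is strongly continuous down to `t = 0`. For `t < 0`, where `√t = 0`, it is `e^{γt}`. -/
def heatFlow {α : ℝ} (hα : 0 < α) (β γ t : ℝ) : Cu →L[ℂ] Cu :=
  LinearMap.mkContinuous
    { toFun := fun f => (Complex.exp (γ * t)) •
        ∫ z, cglKernel α β 0 1 z • Cu.translate (√t * z) f
      map_add' := fun f g => by
        rw [← smul_add, ← integral_add (cglKernel_smul_translate_integrable hα β _ f)
          (cglKernel_smul_translate_integrable hα β _ g)]
        simp_rw [← smul_add]
        rfl
      map_smul' := fun c f => by
        rw [RingHom.id_apply, smul_comm c, ← integral_smul c]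
        simp_rw [smul_comm c]
        rfl }
    (Real.exp (γ * t) * ∫ z, ‖cglKernel α β 0 1 z‖) fun f => by
      have h1 : ‖∫ z, cglKernel α β 0 1 z • Cu.translate (√t * z) f‖ ≤
          ∫ z, ‖cglKernel α β 0 1 z‖ * ‖f‖ :=
        norm_integral_le_of_norm_le
          ((cglKernel_integrable hα β 0 one_pos).norm.mul_const ‖f‖)
          (Eventually.of_forall fun z => by
            rw [norm_smul]
            exact mul_le_mul_of_nonneg_left (Cu.norm_translate_le _ _) (norm_nonneg _))
      have h2 : ‖Complex.exp (γ * t)‖ = Real.exp (γ * t) := by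
        rw [← Complex.ofReal_mul, Complex.norm_exp_ofReal]
      change ‖Complex.exp (γ * t) • ∫ z, cglKernel α β 0 1 z • Cu.translate (√t * z) f‖ ≤ _
      rw [norm_smul, h2, mul_assoc, ← integral_mul_const]
      exact mul_le_mul_of_nonneg_left h1 (Real.exp_pos _).le

theorem heatFlow_apply {α : ℝ} (hα : 0 < α) (β γ t : ℝ) (f : Cu) :
    heatFlow hα β γ t f = Complex.exp (γ * t) •
      ∫ z, cglKernel α β 0 1 z • Cu.translate (√t * z) f := rfl

theorem norm_heatFlow_le {α : ℝ} (hα : 0 < α) (β γ t : ℝ) :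
    ‖heatFlow hα β γ t‖ ≤ Real.exp (γ * t) * ∫ z, ‖cglKernel α β 0 1 z‖ :=
  LinearMap.mkContinuous_norm_le _
    (mul_nonneg (Real.exp_pos _).le (integral_nonneg fun _ => norm_nonneg _)) _

theorem heatFlow_apply_apply {α : ℝ} (hα : 0 < α) (β γ t : ℝ) (f : Cu) (x : ℝ) :
    (heatFlow hα β γ t f).1 x = Complex.exp (γ * t) *
      ∫ z, cglKernel α β 0 1 z * f.1 (x - √t * z) := by
  rw [← Cu.evalL_apply, heatFlow_apply, map_smul, smul_eq_mul,
    ← ContinuousLinearMap.integral_comp_comm _ (cglKernel_smul_translate_integrable hα β _ f)]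
  rfl

theorem cglSemigroup_eq_heatFlow {α : ℝ} (hα : 0 < α) (β γ : ℝ) {t : ℝ} (ht : 0 ≤ t) (f : Cu) :
    cglSemigroup hα β γ t f = heatFlow hα β γ t f := by
  refine Cu.ext_apply fun x => ?_
  rw [heatFlow_apply_apply]
  rcases ht.eq_or_lt with rfl | ht
  · simp [cglSemigroup, integral_mul_const, integral_cglKernel_one hα β]
  · rw [cglSemigroup, dif_pos ht]
    change ∫ y, cglKernel α β γ t y * f.1 (x - y) = _
    have hs : 0 < √t := Real.sqrt_pos.2 ht
    have h := Measure.integral_comp_mul_left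
      (fun y => cglKernel α β γ t y * f.1 (x - y)) √t
    have h2 : ∫ y, cglKernel α β γ t y * f.1 (x - y) =
        (√t : ℂ) * ∫ z, cglKernel α β γ t (√t * z) * f.1 (x - √t * z) := by
      rw [h, abs_of_pos (inv_pos.2 hs), Complex.real_smul, ← mul_assoc, ← Complex.ofReal_mul,
        mul_inv_cancel₀ hs.ne', Complex.ofReal_one, one_mul]
    rw [h2, ← integral_const_mul, ← integral_const_mul]
    congr 1
    funext z
    rw [← mul_assoc, sqrt_mul_cglKernel hα β γ ht, mul_assoc]

theorem continuous_heatFlow_apply {α : ℝ} (hα : 0 < α) (β γ : ℝ) (f : Cu) :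
    Continuous fun t => heatFlow hα β γ t f := by
  simp_rw [heatFlow_apply]
  have he : Continuous fun t : ℝ => Complex.exp (γ * t) := by fun_prop
  suffices hg : Continuous fun t : ℝ =>
      ∫ z, cglKernel α β 0 1 z • Cu.translate (√t * z) f from he.smul hg
  refine continuous_of_dominated
    (bound := fun z => ‖cglKernel α β 0 1 z‖ * ‖f‖)
    (fun t => (cglKernel_smul_translate_integrable hα β _ f).aestronglyMeasurable)
    (fun t => Eventually.of_forall fun z => ?_)
    ((cglKernel_integrable hα β 0 one_pos).norm.mul_const ‖f‖)
    (Eventually.of_forall fun z => ?_)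
  · rw [norm_smul]
    exact mul_le_mul_of_nonneg_left (Cu.norm_translate_le _ _) (norm_nonneg _)
  · have hz : Continuous fun t : ℝ => Cu.translate (√t * z) f :=
      (Cu.continuous_translate f).comp (Real.continuous_sqrt.mul continuous_const)
    exact hz.const_smul (cglKernel α β 0 1 z)

/-- Strong continuity and local boundedness give joint continuity. -/
theorem continuous_heatFlow {α : ℝ} (hα : 0 < α) (β γ : ℝ) :
    Continuous fun p : ℝ × Cu => heatFlow hα β γ p.1 p.2 := by
  refine continuous_iff_continuousAt.2 fun ⟨t, f⟩ => ?_
  set K : ℝ := ∫ z, ‖cglKernel α β 0 1 z‖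
  have h1 : Tendsto (fun p : ℝ × Cu => heatFlow hα β γ p.1 (p.2 - f)) (𝓝 (t, f)) (𝓝 0) := by
    refine squeeze_zero_norm (a := fun p : ℝ × Cu => Real.exp (γ * p.1) * K * ‖p.2 - f‖)
      (fun p => (ContinuousLinearMap.le_opNorm _ _).trans
        (mul_le_mul_of_nonneg_right (norm_heatFlow_le hα β γ _) (norm_nonneg _))) ?_
    have : Continuous fun p : ℝ × Cu => Real.exp (γ * p.1) * K * ‖p.2 - f‖ := by fun_prop
    refine this.tendsto' _ _ ?_
    change Real.exp (γ * t) * K * ‖f - f‖ = 0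
    rw [sub_self, norm_zero, mul_zero]
  have h2 : Tendsto (fun p : ℝ × Cu => heatFlow hα β γ p.1 f) (𝓝 (t, f))
      (𝓝 (heatFlow hα β γ t f)) :=
    ((continuous_heatFlow_apply hα β γ f).comp continuous_fst).tendsto (t, f)
  have h3 := h1.add h2
  rw [zero_add] at h3
  refine h3.congr fun p => ?_
  rw [map_sub, sub_add_cancel]

/-- The waves are eigenfunctions of the semigroup. The square of `√t` is `max t 0`. -/
theorem heatFlow_wave {α : ℝ} (hα : 0 < α) (β γ t ξ : ℝ) :
    heatFlow hα β γ t (Cu.wave ξ) =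
      Complex.exp (γ * t - (α + β * Complex.I) * (ξ * √t) ^ 2) • Cu.wave ξ := by
  refine Cu.ext_apply fun x => ?_
  rw [heatFlow_apply_apply, ← Cu.evalL_apply x (_ • _), map_smul, Cu.evalL_apply, smul_eq_mul]
  have e : ∀ z : ℝ, cglKernel α β 0 1 z * (Cu.wave ξ).1 (x - √t * z) =
      (cglKernel α β 0 1 z * Complex.exp (Complex.I * ((-(ξ * √t) : ℝ) : ℂ) * z)) *
        (Cu.wave ξ).1 x := by
    intro z
    rw [Cu.wave_apply, Cu.wave_apply, mul_assoc (cglKernel α β 0 1 z), ← Complex.exp_add]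
    push_cast
    ring_nf
  simp_rw [e]
  rw [integral_mul_const, integral_cglKernel_mul_exp hα, ← mul_assoc, ← Complex.exp_add]
  push_cast
  ring_nf

/-! ### The polynomial nonlinearity -/

theorem lipschitzOnBalls_aeval {A : Type*} [NormedRing A] [NormedAlgebra ℂ A]
    (B : Polynomial ℂ) : LipschitzOnBalls fun f : A => Polynomial.aeval f B := by
  induction B using Polynomial.induction_on with
  | C a => exact fun R => ⟨0, le_rfl, fun f g _ _ => by simp⟩
  | add p q hp hq =>
    intro R
    obtain ⟨L₁, h₁, hp⟩ := hp R
    obtain ⟨L₂, h₂, hq⟩ := hq R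
    refine ⟨L₁ + L₂, add_nonneg h₁ h₂, fun f g hf hg => ?_⟩
    simp only [map_add]
    rw [add_sub_add_comm, add_mul]
    exact (norm_add_le _ _).trans (add_le_add (hp f g hf hg) (hq f g hf hg))
  | monomial n a hp =>
    intro R
    obtain ⟨L, hL, hp⟩ := hp R
    set p : Polynomial ℂ := Polynomial.C a * Polynomial.X ^ n
    have hpX : Polynomial.C a * Polynomial.X ^ (n + 1) = p * Polynomial.X := by
      rw [pow_succ, ← mul_assoc]
    refine ⟨L * |R| + (‖Polynomial.aeval (0 : A) p‖ + L * |R|), by positivity,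
      fun f g hf hg => ?_⟩
    have hf' : ‖f‖ ≤ |R| := hf.trans (le_abs_self R)
    have hg' : ‖g‖ ≤ |R| := hg.trans (le_abs_self R)
    simp only [hpX, map_mul, Polynomial.aeval_X]
    have e : Polynomial.aeval f p * f - Polynomial.aeval g p * g =
        (Polynomial.aeval f p - Polynomial.aeval g p) * f + Polynomial.aeval g p * (f - g) := by
      rw [sub_mul, mul_sub]; abel
    have hb : ‖Polynomial.aeval g p‖ ≤ ‖Polynomial.aeval (0 : A) p‖ + L * |R| := by
      have h1 := hp g 0 hg (by rw [norm_zero]; exact (norm_nonneg g).trans hg)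
      rw [sub_zero] at h1
      have h2 := norm_add_le (Polynomial.aeval (0 : A) p)
        (Polynomial.aeval g p - Polynomial.aeval (0 : A) p)
      rw [add_sub_cancel] at h2
      have h3 := mul_le_mul_of_nonneg_left hg' hL
      simp only at h1
      linarith
    rw [e, add_mul]
    refine (norm_add_le _ _).trans (add_le_add ?_ ?_)
    · refine (norm_mul_le _ _).trans ((mul_le_mul (hp f g hf hg) hf' (norm_nonneg _)
        (by positivity)).trans (le_of_eq (by ring)))
    · exact (norm_mul_le _ _).trans (mul_le_mul_of_nonneg_right hb (norm_nonneg _))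

theorem LipschitzOnBalls.const_smul {A : Type*} [NormedAddCommGroup A] [NormedSpace ℂ A]
    {N : A → A} (hN : LipschitzOnBalls N) (c : ℂ) : LipschitzOnBalls fun f => c • N f := by
  intro R
  obtain ⟨L, hL, h⟩ := hN R
  refine ⟨‖c‖ * L, by positivity, fun f g hf hg => ?_⟩
  rw [← smul_sub, norm_smul, mul_assoc]
  exact mul_le_mul_of_nonneg_left (h f g hf hg) (norm_nonneg _)

/-! ### The space of waves with positive frequencies -/

/-- The closed span in `C_u(ℝ)` of the waves `e^{ijlx}`, `j ≥ 1`. -/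
def waveSpace (l : ℝ) : Submodule ℂ Cu :=
  (Submodule.span ℂ (Set.range fun j : ℕ => Cu.wave ((j + 1 : ℕ) * l))).topologicalClosure

theorem isClosed_waveSpace (l : ℝ) : IsClosed (waveSpace l : Set Cu) :=
  Submodule.isClosed_topologicalClosure _

theorem wave_mem_waveSpace (l : ℝ) (j : ℕ) : Cu.wave ((j + 1 : ℕ) * l) ∈ waveSpace l :=
  Submodule.le_topologicalClosure _ (Submodule.subset_span ⟨j, rfl⟩)

theorem Cu.wave_mul_wave (ξ η : ℝ) : Cu.wave ξ * Cu.wave η = Cu.wave (ξ + η) :=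
  Cu.ext_apply fun x => by
    change Complex.exp (Complex.I * ξ * x) * Complex.exp (Complex.I * η * x) =
      Complex.exp (Complex.I * (ξ + η : ℝ) * x)
    rw [← Complex.exp_add]
    push_cast
    ring_nf

theorem mul_mem_waveSpace {l : ℝ} {f g : Cu} (hf : f ∈ waveSpace l) (hg : g ∈ waveSpace l) :
    f * g ∈ waveSpace l := by
  refine map_mem_closure₂ continuous_mul hf hg fun f hf g hg => ?_
  refine Submodule.mul_induction_on (C := fun h => h ∈ Submodule.span ℂ
    (Set.range fun j : ℕ => Cu.wave ((j + 1 : ℕ) * l))) (Submodule.mul_mem_mul hf hg) ?_ ?_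
  · intro f hf g hg
    have h := Submodule.mul_mem_mul hf hg
    rw [Submodule.span_mul_span] at h
    refine Submodule.span_mono ?_ h
    rintro _ ⟨_, ⟨j, rfl⟩, _, ⟨k, rfl⟩, rfl⟩
    refine ⟨j + k + 1, ?_⟩
    change Cu.wave _ = Cu.wave _ * Cu.wave _
    rw [Cu.wave_mul_wave]
    congr 1
    push_cast
    ring
  · exact fun f g hf hg => add_mem hf hg

theorem aeval_mem_waveSpace {l : ℝ} {B : Polynomial ℂ} (hB : B.eval 0 = 0) {f : Cu}
    (hf : f ∈ waveSpace l) : Polynomial.aeval f B ∈ waveSpace l := by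
  have hpow : ∀ n : ℕ, f ^ (n + 1) ∈ waveSpace l := by
    intro n
    induction n with
    | zero => simpa using hf
    | succ n ih => rw [pow_succ]; exact mul_mem_waveSpace ih hf
  rw [Polynomial.aeval_eq_sum_range]
  refine Submodule.sum_mem _ fun i _ => ?_
  rcases i with _ | i
  · rw [Polynomial.coeff_zero_eq_eval_zero, hB, zero_smul]
    exact Submodule.zero_mem _
  · exact Submodule.smul_mem _ _ (hpow i)

theorem heatFlow_mem_waveSpace {α : ℝ} (hα : 0 < α) (β γ t : ℝ) {l : ℝ} {f : Cu}
    (hf : f ∈ waveSpace l) : heatFlow hα β γ t f ∈ waveSpace l := by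
  refine map_mem_closure (heatFlow hα β γ t).continuous hf fun f hf => ?_
  change f ∈ (Submodule.span ℂ (Set.range fun j : ℕ => Cu.wave ((j + 1 : ℕ) * l))).comap
    (heatFlow hα β γ t).toLinearMap
  refine Submodule.span_le.2 ?_ hf
  rintro _ ⟨j, rfl⟩
  change heatFlow hα β γ t _ ∈ Submodule.span ℂ _
  rw [heatFlow_wave]
  exact Submodule.smul_mem _ _ (Submodule.subset_span ⟨j, rfl⟩)

theorem summable_smul_wave {a : ℕ → ℂ} (ha : Summable fun j => ‖a j‖) (l : ℝ) :
    Summable fun j : ℕ => a j • Cu.wave ((j + 1 : ℕ) * l) :=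
  Summable.of_norm_bounded ha fun j => by
    rw [norm_smul]
    exact mul_le_of_le_one_right (norm_nonneg _) (Cu.norm_wave_le _)

theorem tsum_smul_wave_mem_waveSpace {a : ℕ → ℂ} (ha : Summable fun j => ‖a j‖) (l : ℝ) :
    ∑' j : ℕ, a j • Cu.wave ((j + 1 : ℕ) * l) ∈ waveSpace l :=
  (isClosed_waveSpace l).mem_of_tendsto (summable_smul_wave ha l).hasSum
    (Eventually.of_forall fun _ => Submodule.sum_mem _ fun j _ =>
      Submodule.smul_mem _ _ (wave_mem_waveSpace l j))

theorem hasSum_apply_tsum_smul_wave {a : ℕ → ℂ} (ha : Summable fun j => ‖a j‖) (l x : ℝ) :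
    HasSum (fun j : ℕ => a j * Complex.exp (Complex.I * ((j + 1 : ℕ) : ℂ) * l * x))
      ((∑' j : ℕ, a j • Cu.wave ((j + 1 : ℕ) * l) : Cu).1 x) := by
  have h := (Cu.evalL x).hasSum (summable_smul_wave ha l).hasSum
  rw [Cu.evalL_apply] at h
  refine h.congr_fun fun j => ?_
  rw [map_smul, Cu.evalL_apply, Cu.wave_apply, smul_eq_mul]
  push_cast
  ring_nf

theorem ALambda_subset_waveSpace (l : ℝ) : ALambda l ⊆ waveSpace l := by
  rintro u ⟨a, ha, h⟩
  have e : u = ∑' j : ℕ, a j • Cu.wave ((j + 1 : ℕ) * l) :=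
    Cu.ext_apply fun x => (h x).unique (hasSum_apply_tsum_smul_wave ha l x)
  rw [e]
  exact tsum_smul_wave_mem_waveSpace ha l

/-! ### Fourier coefficients -/

/-- The coefficient of `e^{i(k+1)lx}`, as the average of `f(y / l) e^{-i(k+1)y}` over
`0 ≤ y ≤ 2π`. It is meaningful for `l ≠ 0`. -/
def waveCoeff (l : ℝ) (k : ℕ) : Cu →L[ℂ] ℂ :=
  LinearMap.mkContinuous
    { toFun := fun f => (2 * Real.pi : ℂ)⁻¹ * ∫ y in (0 : ℝ)..2 * Real.pi,
        f.1 (y / l) * Complex.exp (-(Complex.I * (k + 1 : ℕ) * y))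
      map_add' := fun f g => by
        have hi : ∀ f : Cu, IntervalIntegrable (fun y : ℝ => f.1 (y / l) *
            Complex.exp (-(Complex.I * (k + 1 : ℕ) * y))) volume 0 (2 * Real.pi) := fun f =>
          ((f.1.continuous.comp (continuous_id.div_const l)).mul
            (by fun_prop)).intervalIntegrable _ _
        rw [← mul_add, ← intervalIntegral.integral_add (hi f) (hi g)]
        simp_rw [← add_mul]
        rfl
      map_smul' := fun c f => by
        rw [RingHom.id_apply, smul_eq_mul, mul_left_comm c,
          ← intervalIntegral.integral_const_mul c]
        simp_rw [← mul_assoc c]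
        rfl }
    1 fun f => by
      have h := intervalIntegral.norm_integral_le_of_norm_le_const (a := 0) (b := 2 * Real.pi)
        (C := ‖f‖) (f := fun y : ℝ => f.1 (y / l) *
          Complex.exp (-(Complex.I * (k + 1 : ℕ) * y))) fun y _ => by
        have e : -(Complex.I * (k + 1 : ℕ) * y) = ((-((k + 1 : ℕ) * y) : ℝ) : ℂ) * Complex.I := by
          push_cast; ring
        rw [norm_mul, e, Complex.norm_exp_ofReal_mul_I, mul_one]
        exact f.1.norm_coe_le_norm _
      have hπ : 0 < 2 * Real.pi := by positivity
      rw [sub_zero, abs_of_pos hπ] at h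
      change ‖(2 * Real.pi : ℂ)⁻¹ * _‖ ≤ _
      have hn : ‖(2 * Real.pi : ℂ)‖ = 2 * Real.pi := by
        rw [norm_mul, Complex.norm_real, Real.norm_of_nonneg Real.pi_pos.le]; simp
      rw [norm_mul, norm_inv, hn, one_mul, inv_mul_le_iff₀ hπ, mul_comm (2 * Real.pi)]
      exact h

theorem norm_waveCoeff_le (l : ℝ) (k : ℕ) : ‖waveCoeff l k‖ ≤ 1 :=
  LinearMap.mkContinuous_norm_le _ zero_le_one _

theorem norm_waveCoeff_apply_le (l : ℝ) (k : ℕ) (f : Cu) : ‖waveCoeff l k f‖ ≤ ‖f‖ :=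
  ((waveCoeff l k).le_of_opNorm_le (norm_waveCoeff_le l k) f).trans (one_mul _).le

theorem waveCoeff_wave {l : ℝ} (hl : l ≠ 0) (j k : ℕ) :
    waveCoeff l k (Cu.wave ((j + 1 : ℕ) * l)) = if j = k then 1 else 0 := by
  change (2 * Real.pi : ℂ)⁻¹ * ∫ y in (0 : ℝ)..2 * Real.pi,
    (Cu.wave ((j + 1 : ℕ) * l)).1 (y / l) * Complex.exp (-(Complex.I * (k + 1 : ℕ) * y)) = _
  have hlc : (l : ℂ) ≠ 0 := by exact_mod_cast hl
  have hπ : (2 * Real.pi : ℂ) ≠ 0 := by simp [Real.pi_ne_zero]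
  have e : ∀ y : ℝ, (Cu.wave ((j + 1 : ℕ) * l)).1 (y / l) *
      Complex.exp (-(Complex.I * (k + 1 : ℕ) * y)) =
      Complex.exp ((Complex.I * ((j : ℂ) - k)) * y) := by
    intro y
    rw [Cu.wave_apply, ← Complex.exp_add]
    congr 1
    push_cast
    field_simp
    ring
  simp_rw [e]
  split_ifs with h
  · simp only [h, sub_self, mul_zero, zero_mul, Complex.exp_zero, intervalIntegral.integral_const,
      sub_zero, Complex.real_smul, mul_one]
    push_cast
    exact inv_mul_cancel₀ hπ
  · have hc : Complex.I * ((j : ℂ) - k) ≠ 0 :=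
      mul_ne_zero Complex.I_ne_zero (sub_ne_zero.2 (by exact_mod_cast h))
    rw [integral_exp_mul_complex hc]
    have h1 : Complex.exp (Complex.I * ((j : ℂ) - k) * (2 * Real.pi : ℝ)) = 1 := by
      rw [Complex.exp_eq_one_iff]
      exact ⟨(j : ℤ) - k, by push_cast; ring⟩
    rw [h1]
    simp

/-- Two operators that agree on the waves agree on their closed span. -/
theorem eqOn_waveSpace {F : Type*} [NormedAddCommGroup F] [NormedSpace ℂ F] {l : ℝ}
    {P Q : Cu →L[ℂ] F}
    (h : ∀ j : ℕ, P (Cu.wave ((j + 1 : ℕ) * l)) = Q (Cu.wave ((j + 1 : ℕ) * l))) {f : Cu}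
    (hf : f ∈ waveSpace l) : P f = Q f := by
  refine ContinuousLinearMap.eqOn_closure_span (s := Set.range fun j : ℕ =>
    Cu.wave ((j + 1 : ℕ) * l)) ?_ hf
  rintro _ ⟨j, rfl⟩
  exact h j

/-- The factor by which the flow at time `t ≥ 0` multiplies `e^{iξx}`. -/
def heatSymbol (α β γ t ξ : ℝ) : ℂ :=
  Complex.exp (γ * t - (α + β * Complex.I) * (ξ * √t) ^ 2)

theorem norm_heatSymbol (α β γ : ℝ) {t : ℝ} (ht : 0 ≤ t) (ξ : ℝ) :
    ‖heatSymbol α β γ t ξ‖ = Real.exp (γ * t) * Real.exp (-(α * ξ ^ 2 * t)) := by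
  have hsq : (√t : ℂ) ^ 2 = t := by
    rw [← Complex.ofReal_pow, Real.sq_sqrt ht]
  have e : (γ * t - (α + β * Complex.I) * (ξ * √t) ^ 2 : ℂ) =
      ((γ * t - α * ξ ^ 2 * t : ℝ) : ℂ) + ((-(β * ξ ^ 2 * t) : ℝ) : ℂ) * Complex.I := by
    rw [mul_pow, hsq]
    push_cast
    ring
  rw [heatSymbol, Complex.norm_exp, e, Complex.add_re, Complex.ofReal_re, Complex.re_ofReal_mul,
    Complex.I_re, mul_zero, add_zero, sub_eq_add_neg, Real.exp_add]

theorem waveCoeff_heatFlow {α : ℝ} (hα : 0 < α) (β γ t : ℝ) {l : ℝ} (hl : l ≠ 0) (k : ℕ)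
    {f : Cu} (hf : f ∈ waveSpace l) :
    waveCoeff l k (heatFlow hα β γ t f) =
      heatSymbol α β γ t ((k + 1 : ℕ) * l) * waveCoeff l k f := by
  refine eqOn_waveSpace (P := (waveCoeff l k).comp (heatFlow hα β γ t))
    (Q := heatSymbol α β γ t ((k + 1 : ℕ) * l) • waveCoeff l k) (fun j => ?_) hf
  change waveCoeff l k (heatFlow hα β γ t _) = _ * waveCoeff l k _
  rw [heatFlow_wave, map_smul, waveCoeff_wave hl, smul_eq_mul]
  split_ifs with h
  · rw [h, heatSymbol]
  · rw [mul_zero, mul_zero]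

theorem summable_one_div_rate {α l : ℝ} (hα : 0 < α) (hl : l ≠ 0) :
    Summable fun j : ℕ => 1 / (α * ((j + 1 : ℕ) * l) ^ 2) := by
  have h := ((summable_nat_add_iff 1).2
    (Real.summable_one_div_nat_pow.2 one_lt_two)).mul_left (1 / (α * l ^ 2))
  refine h.congr fun j => ?_
  field_simp

theorem rate_pos {α l : ℝ} (hα : 0 < α) (hl : l ≠ 0) (j : ℕ) :
    0 < α * ((j + 1 : ℕ) * l) ^ 2 := by
  have : ((j + 1 : ℕ) : ℝ) ≠ 0 := by positivity
  positivity

theorem exp_neg_le_one_div {x : ℝ} (hx : 0 < x) : Real.exp (-x) ≤ 1 / x := by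
  rw [Real.exp_neg, ← one_div]
  exact one_div_le_one_div_of_le hx (by linarith [Real.add_one_le_exp x])

theorem summable_norm_heatSymbol {α : ℝ} (hα : 0 < α) (β γ : ℝ) {l t : ℝ} (hl : l ≠ 0)
    (ht : 0 < t) : Summable fun j : ℕ => ‖heatSymbol α β γ t ((j + 1 : ℕ) * l)‖ := by
  refine Summable.of_nonneg_of_le (fun _ => norm_nonneg _) (fun j => ?_)
    ((summable_one_div_rate hα hl).mul_left (Real.exp (γ * t) * (1 / t)))
  rw [norm_heatSymbol α β γ ht.le, mul_assoc (Real.exp (γ * t))]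
  refine mul_le_mul_of_nonneg_left ?_ (Real.exp_pos _).le
  refine (exp_neg_le_one_div (mul_pos (rate_pos hα hl j) ht)).trans (le_of_eq ?_)
  rw [one_div_mul_one_div, mul_comm t]

/-- An operator that is diagonal on a biorthogonal system `(e, φ)`, with absolutely summable
eigenvalues `m`, has the norm-convergent expansion `∑ m_j φ_j(·) e_j` on the closed span of `e`; so
it kills every element of the closed span whose coefficients vanish. -/
theorem diagonal_apply_eq_zero {E : Type*} [NormedAddCommGroup E] [NormedSpace ℂ E]
    [CompleteSpace E] {e : ℕ → E} {φ : ℕ → E →L[ℂ] ℂ} {m : ℕ → ℂ} {P : E →L[ℂ] E}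
    (he : ∀ j, ‖e j‖ ≤ 1) (hφ : ∀ j, ‖φ j‖ ≤ 1) (hm : Summable fun j => ‖m j‖)
    (hφe : ∀ i j, φ i (e j) = if j = i then 1 else 0) (hP : ∀ j, P (e j) = m j • e j)
    {f : E} (hf : f ∈ closure (Submodule.span ℂ (Set.range e) : Set E))
    (h0 : ∀ j, φ j f = 0) : P f = 0 := by
  obtain ⟨T, hT⟩ : ∃ T : ℕ → E →L[ℂ] E, ∀ j, T j = m j • (φ j).smulRight (e j) :=
    ⟨_, fun _ => rfl⟩
  have hTa : ∀ j g, T j g = m j • φ j g • e j := fun j g => by rw [hT]; rfl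
  have hs : Summable T := by
    refine Summable.of_norm_bounded hm fun j => ?_
    rw [hT, norm_smul, ContinuousLinearMap.norm_smulRight_apply]
    exact mul_le_of_le_one_right (norm_nonneg _)
      (mul_le_one₀ (hφ j) (norm_nonneg _) (he j))
  obtain ⟨Q, hQ⟩ := hs
  have happ : ∀ g, HasSum (fun j => T j g) (Q g) := fun g => by
    have h := (ContinuousLinearMap.apply ℂ E g).hasSum hQ
    exact h
  have hPT : Set.EqOn P Q (Set.range e) := by
    rintro _ ⟨j, rfl⟩
    have h1 : HasSum (fun i => T i (e j)) (T j (e j)) := hasSum_single j fun i hi => by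
      rw [hTa, hφe, if_neg hi.symm, zero_smul, smul_zero]
    rw [(happ _).unique h1, hP, hTa, hφe, if_pos rfl, one_smul]
  rw [ContinuousLinearMap.eqOn_closure_span hPT hf]
  refine (happ f).unique ?_
  simp_rw [hTa, h0, zero_smul, smul_zero]
  exact hasSum_zero

/-- Injectivity of the Fourier coefficients: the heat flow at positive time is an absolutely
convergent series in the coefficients, and it tends to the identity as the time tends to `0`. -/
theorem eq_zero_of_waveCoeff_eq_zero {l : ℝ} (hl : l ≠ 0) {f : Cu} (hf : f ∈ waveSpace l)
    (h0 : ∀ k, waveCoeff l k f = 0) : f = 0 := by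
  have key : ∀ t > 0, heatFlow one_pos 0 0 t f = 0 := fun t ht =>
    diagonal_apply_eq_zero (e := fun j : ℕ => Cu.wave ((j + 1 : ℕ) * l)) (φ := waveCoeff l)
      (m := fun j => heatSymbol 1 0 0 t ((j + 1 : ℕ) * l))
      (fun j => Cu.norm_wave_le _) (norm_waveCoeff_le l)
      (summable_norm_heatSymbol one_pos 0 0 hl ht) (fun i j => waveCoeff_wave hl j i)
      (fun j => heatFlow_wave one_pos 0 0 t _) hf h0
  have h1 : Tendsto (fun t => heatFlow one_pos 0 0 t f) (𝓝[>] 0)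
      (𝓝 (heatFlow one_pos 0 0 0 f)) :=
    ((continuous_heatFlow_apply one_pos 0 0 f).tendsto 0).mono_left nhdsWithin_le_nhds
  have h2 : Tendsto (fun t => heatFlow one_pos 0 0 t f) (𝓝[>] 0) (𝓝 0) :=
    tendsto_const_nhds.congr' (by
      filter_upwards [self_mem_nhdsWithin] with t ht using (key t ht).symm)
  have h3 := tendsto_nhds_unique h1 h2
  rwa [← cglSemigroup_eq_heatFlow one_pos 0 0 le_rfl, cglSemigroup, dif_neg (lt_irrefl _)] at h3

theorem mem_ALambda_of_summable_waveCoeff {l : ℝ} (hl : l ≠ 0) {f : Cu} (hf : f ∈ waveSpace l)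
    (hs : Summable fun k => ‖waveCoeff l k f‖) : f ∈ ALambda l := by
  have e : f = ∑' j : ℕ, waveCoeff l j f • Cu.wave ((j + 1 : ℕ) * l) := by
    refine sub_eq_zero.1 (eq_zero_of_waveCoeff_eq_zero hl
      (sub_mem hf (tsum_smul_wave_mem_waveSpace hs l)) fun k => ?_)
    rw [map_sub, sub_eq_zero]
    refine HasSum.unique ?_ ((waveCoeff l k).hasSum (summable_smul_wave hs l).hasSum)
    have h1 := hasSum_single (f := fun j =>
      waveCoeff l k (waveCoeff l j f • Cu.wave ((j + 1 : ℕ) * l))) k fun j hj => by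
        rw [map_smul, waveCoeff_wave hl, if_neg hj, smul_zero]
    rwa [map_smul, waveCoeff_wave hl, if_pos rfl, smul_eq_mul, mul_one] at h1
  refine ⟨fun j => waveCoeff l j f, hs, fun x => ?_⟩
  have h := hasSum_apply_tsum_smul_wave hs l x
  rwa [← e] at h

/-- For `l = 0` the closed span of the waves and `A₀(ℝ)` both consist of the constants. -/
theorem waveSpace_zero_subset_ALambda : (waveSpace 0 : Set Cu) ⊆ ALambda 0 := by
  intro f hf
  have hc : ∀ x, f.1 x = f.1 0 := fun x =>
    eqOn_waveSpace (P := Cu.evalL x) (Q := Cu.evalL 0) (fun j => by simp) hf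
  refine ⟨fun j => if j = 0 then f.1 0 else 0, ?_, fun x => ?_⟩
  · exact summable_of_ne_finset_zero (s := {0}) fun j hj => by
      have hj' : j ≠ 0 := by simpa using hj
      simp [hj']
  · rw [hc x]
    have h := hasSum_single (f := fun j : ℕ => (if j = 0 then f.1 0 else 0) *
      Complex.exp (Complex.I * ((j + 1 : ℕ) : ℂ) * (0 : ℝ) * x)) 0 fun j hj => by
        rw [if_neg hj, zero_mul]
    simpa using h

/-! ### Smoothing of the Duhamel integral and the mild solution -/

theorem integral_exp_neg_mul_sub_le {κ : ℝ} (hκ : 0 < κ) (t : ℝ) :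
    ∫ s in (0 : ℝ)..t, Real.exp (-(κ * (t - s))) ≤ 1 / κ := by
  have hd : ∀ s ∈ Set.uIcc 0 t, HasDerivAt (fun s => Real.exp (-(κ * (t - s))) / κ)
      (Real.exp (-(κ * (t - s)))) s := fun s _ => by
    have h1 : HasDerivAt (fun s : ℝ => -(κ * (t - s))) κ s := by
      simpa using (((hasDerivAt_id s).const_sub t).const_mul κ).fun_neg
    have h2 := h1.exp.div_const κ
    rwa [mul_div_cancel_right₀ _ hκ.ne'] at h2
  rw [intervalIntegral.integral_eq_sub_of_hasDerivAt hd
    (Continuous.intervalIntegrable (by fun_prop) _ _)]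
  simp only [sub_self, mul_zero, neg_zero, Real.exp_zero]
  have : 0 ≤ Real.exp (-(κ * (t - 0))) / κ := by positivity
  linarith

/-- The semigroup as a family of real-linear operators, as the interval integral requires. -/
def heatFlowReal {α : ℝ} (hα : 0 < α) (β γ t : ℝ) : Cu →L[ℝ] Cu :=
  (heatFlow hα β γ t).restrictScalars ℝ

theorem norm_heatFlowReal_le {α : ℝ} (hα : 0 < α) (β : ℝ) {γ : ℝ} (hγ : 0 ≤ γ) {T : ℝ} :
    ∀ t ∈ Set.Icc 0 T,
      ‖heatFlowReal hα β γ t‖ ≤ Real.exp (γ * T) * ∫ z, ‖cglKernel α β 0 1 z‖ := by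
  intro t ht
  rw [heatFlowReal, ContinuousLinearMap.norm_restrictScalars]
  refine (norm_heatFlow_le hα β γ t).trans (mul_le_mul_of_nonneg_right ?_
    (integral_nonneg fun _ => norm_nonneg _))
  exact Real.exp_le_exp.2 (mul_le_mul_of_nonneg_left ht.2 hγ)

/-- The gain of two derivatives by the Duhamel integral: the `k`-th coefficient of a bounded source
contributes `O(1 / k²)`. -/
theorem norm_waveCoeff_duhamel_le {α : ℝ} (hα : 0 < α) (β : ℝ) {γ : ℝ} (hγ : 0 ≤ γ) {l : ℝ}
    (hl : l ≠ 0) {N : Cu → Cu} (hN : Continuous N) {u₀ : Cu} (hu₀ : u₀ ∈ waveSpace l)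
    {v : ℝ → Cu} (hv : Continuous v) {t M : ℝ} (ht : 0 ≤ t)
    (hNv : ∀ s ∈ Set.Ioc 0 t, N (v s) ∈ waveSpace l) (hM : ∀ s ∈ Set.Ioc 0 t, ‖N (v s)‖ ≤ M)
    (hM0 : 0 ≤ M) (k : ℕ) :
    ‖waveCoeff l k (duhamel (heatFlowReal hα β γ) N u₀ v t)‖ ≤
      ‖heatSymbol α β γ t ((k + 1 : ℕ) * l)‖ * ‖u₀‖ +
        Real.exp (γ * t) * M * (1 / (α * ((k + 1 : ℕ) * l) ^ 2)) := by
  set κ : ℝ := α * ((k + 1 : ℕ) * l) ^ 2 with hκ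
  have hκ0 : 0 < κ := rate_pos hα hl k
  rw [duhamel, map_add, ← ContinuousLinearMap.coe_restrictScalars' (R := ℝ) (waveCoeff l k),
    ← ContinuousLinearMap.intervalIntegral_comp_comm _
      (intervalIntegrable_duhamel_integrand (S := heatFlowReal hα β γ)
        (continuous_heatFlow hα β γ) hN hv t)]
  refine (norm_add_le _ _).trans (add_le_add ?_ ?_)
  · change ‖waveCoeff l k (heatFlow hα β γ t u₀)‖ ≤ _
    rw [waveCoeff_heatFlow hα β γ t hl k hu₀, norm_mul]
    exact mul_le_mul_of_nonneg_left (norm_waveCoeff_apply_le l k u₀) (norm_nonneg _)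
  · have h1 : ‖∫ s in (0 : ℝ)..t, waveCoeff l k (heatFlow hα β γ (t - s) (N (v s)))‖ ≤
        ∫ s in (0 : ℝ)..t, Real.exp (γ * t) * M * Real.exp (-(κ * (t - s))) := by
      refine intervalIntegral.norm_integral_le_of_norm_le ht
        (Eventually.of_forall fun s hs => ?_)
        (Continuous.intervalIntegrable (by fun_prop) _ _)
      rw [waveCoeff_heatFlow hα β γ _ hl k (hNv s hs), norm_mul,
        norm_heatSymbol α β γ (sub_nonneg.2 hs.2), ← hκ, mul_right_comm _ M]
      refine mul_le_mul (mul_le_mul_of_nonneg_right (Real.exp_le_exp.2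
        (mul_le_mul_of_nonneg_left (by linarith [hs.1]) hγ)) (Real.exp_pos _).le)
        ((norm_waveCoeff_apply_le l k _).trans (hM s hs)) (norm_nonneg _) (by positivity)
    refine h1.trans ?_
    rw [intervalIntegral.integral_const_mul]
    exact mul_le_mul_of_nonneg_left (integral_exp_neg_mul_sub_le hκ0 t) (by positivity)

/-- A solution with values in the closed span of the waves has absolutely summable coefficients at
positive times. -/
theorem duhamel_mem_ALambda {α : ℝ} (hα : 0 < α) (β : ℝ) {γ : ℝ} (hγ : 0 ≤ γ) {l : ℝ}
    {N : Cu → Cu} (hN : Continuous N) (hNX : ∀ f ∈ waveSpace l, N f ∈ waveSpace l)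
    {u₀ : Cu} (hu₀ : u₀ ∈ waveSpace l) {u : ℝ → Cu} {t : ℝ} (ht : 0 < t)
    (hu : ContinuousOn u (Set.Icc 0 t)) (huX : ∀ s ∈ Set.Icc 0 t, u s ∈ waveSpace l)
    (hut : u t = duhamel (heatFlowReal hα β γ) N u₀ u t) : u t ∈ ALambda l := by
  have htt : t ∈ Set.Icc 0 t := ⟨ht.le, le_rfl⟩
  rcases eq_or_ne l 0 with rfl | hl
  · exact waveSpace_zero_subset_ALambda (huX t htt)
  obtain ⟨v, hv, hvu, -⟩ := exists_continuous_eqOn_Icc ht.le hu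
  obtain ⟨M, hM⟩ := isCompact_Icc.exists_bound_of_continuousOn (s := Set.Icc 0 t)
    (hN.comp hv).continuousOn
  have hM0 : 0 ≤ M := (norm_nonneg _).trans (hM t htt)
  refine mem_ALambda_of_summable_waveCoeff hl (huX t htt) ?_
  refine Summable.of_nonneg_of_le (fun _ => norm_nonneg _) (fun k => ?_)
    (((summable_norm_heatSymbol hα β γ hl ht).mul_right ‖u₀‖).add
      ((summable_one_div_rate hα hl).mul_left (Real.exp (γ * t) * M)))
  rw [hut, ← duhamel_congr hvu htt]
  refine norm_waveCoeff_duhamel_le hα β hγ hl hN hu₀ hv ht.le (fun s hs => ?_)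
    (fun s hs => hM s (Set.Ioc_subset_Icc_self hs)) hM0 k
  have hs' := Set.Ioc_subset_Icc_self hs
  rw [hvu hs']
  exact hNX _ (huX s hs')

theorem isMildSolution_iff {α : ℝ} (hα : 0 < α) (β γ a b : ℝ) (B : Polynomial ℂ) (u₀ : Cu)
    {J : Set ℝ} (hJ : ∀ t ∈ J, 0 ≤ t) (u : ℝ → Cu) :
    IsMildSolution hα β γ a b B u₀ J u ↔ ContinuousOn u J ∧ ∀ t ∈ J,
      u t = duhamel (heatFlowReal hα β γ)
        (fun f => ((a : ℂ) + b * Complex.I) • Polynomial.aeval f B) u₀ u t := by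
  have key : ∀ t ∈ J, cglSemigroup hα β γ t u₀ + ∫ s in (0 : ℝ)..t, cglSemigroup hα β γ (t - s)
      (((a : ℂ) + b * Complex.I) • Polynomial.aeval (u s) B) =
      duhamel (heatFlowReal hα β γ)
        (fun f => ((a : ℂ) + b * Complex.I) • Polynomial.aeval f B) u₀ u t := by
    intro t ht
    rw [duhamel, cglSemigroup_eq_heatFlow hα β γ (hJ t ht)]
    refine congrArg (heatFlow hα β γ t u₀ + ·) (intervalIntegral.integral_congr fun s hs => ?_)
    rw [Set.uIcc_of_le (hJ t ht)] at hs
    exact cglSemigroup_eq_heatFlow hα β γ (sub_nonneg.2 hs.2) _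
  refine ⟨fun h => ⟨h.1, fun t ht => (h.2 t ht).trans (key t ht)⟩,
    fun h => ⟨h.1, fun t ht => (h.2 t ht).trans (key t ht).symm⟩⟩

theorem mainTheorem1 (α β γ a b lam : ℝ) (hα : 0 < α) (hβ : 0 < β) (hγ : 0 ≤ γ)
    (ha : 0 < a) (hb : 0 < b) (B : Polynomial ℂ) (hB : B.eval 0 = 0)
    (u₀ : Cu) (hu₀ : u₀ ∈ ALambda lam) :
    0 < maxTime hα β γ a b B u₀ ∧
    ∃ u : ℝ → Cu,
      IsMildSolution hα β γ a b B u₀ (maxInterval hα β γ a b B u₀) u ∧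
      (∀ v : ℝ → Cu, IsMildSolution hα β γ a b B u₀ (maxInterval hα β γ a b B u₀) v →
        Set.EqOn v u (maxInterval hα β γ a b B u₀)) ∧
      ∀ t : ℝ, 0 < t → (t : EReal) < maxTime hα β γ a b B u₀ → u t ∈ ALambda lam := by
  set J := maxInterval hα β γ a b B u₀ with hJ
  have hJ0 : ∀ t ∈ J, 0 ≤ t := fun t ht => ht.1
  have hJs : ∀ t ∈ J, Set.Icc 0 t ⊆ J := fun t ht s hs =>
    ⟨hs.1, lt_of_le_of_lt (EReal.coe_le_coe_iff.2 hs.2) ht.2⟩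
  let S := heatFlowReal hα β γ
  let N : Cu → Cu := fun f => ((a : ℂ) + b * Complex.I) • Polynomial.aeval f B
  have hS : Continuous fun p : ℝ × Cu => S p.1 p.2 := continuous_heatFlow hα β γ
  have hN : LipschitzOnBalls N := (lipschitzOnBalls_aeval B).const_smul _
  have hC := fun T => norm_heatFlowReal_le hα β hγ (T := T)
  have hX₀ : u₀ ∈ waveSpace lam := ALambda_subset_waveSpace lam hu₀
  have hNX : ∀ f ∈ waveSpace lam, N f ∈ waveSpace lam := fun f hf =>
    Submodule.smul_mem _ _ (aeval_mem_waveSpace hB hf)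
  have hmild : ∀ T u, IsMildSolution hα β γ a b B u₀ (Set.Icc 0 T) u ↔
      ContinuousOn u (Set.Icc 0 T) ∧ ∀ t ∈ Set.Icc 0 T, u t = duhamel S N u₀ u t := fun T u =>
    isMildSolution_iff hα β γ a b B u₀ (fun t ht => ht.1) u
  refine ⟨?_, ?_⟩
  · obtain ⟨T, hT, u, hu⟩ := exists_duhamel_solution (u₀ := u₀) hS hN (hC 1)
    exact lt_of_lt_of_le (EReal.coe_pos.2 hT)
      (le_sSup ⟨T, hT.le, rfl, u, (hmild T u).2 hu⟩)
  -- for each time `t` of the maximal interval fix a solution `w t` on some `[0, T t]` with `t < T t`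
  have hex : ∀ t : ℝ, ∃ T : ℝ, ∃ w : ℝ → Cu, t ∈ J → t < T ∧
      ContinuousOn w (Set.Icc 0 T) ∧ ∀ s ∈ Set.Icc 0 T, w s = duhamel S N u₀ w s := by
    intro t
    by_cases ht : t ∈ J
    · obtain ⟨_, ⟨T, -, rfl, w, hw⟩, hlt⟩ := lt_sSup_iff.1 ht.2
      exact ⟨T, w, fun _ => ⟨EReal.coe_lt_coe_iff.1 hlt, (hmild T w).1 hw⟩⟩
    · exact ⟨0, fun _ => 0, fun h => absurd h ht⟩
  choose T w hw using hex
  -- two solutions agree up to the smaller of their times, so the diagonal `t ↦ w t t` glues them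
  have hglue : ∀ t ∈ J, ∀ s ∈ J, s ≤ T t → w s s = w t s := by
    intro t ht s hs hsT
    obtain ⟨h1, h2, h3⟩ := hw s hs
    obtain ⟨h4, h5, h6⟩ := hw t ht
    have i1 : Set.Icc 0 s ⊆ Set.Icc 0 (T s) := Set.Icc_subset_Icc_right h1.le
    have i2 : Set.Icc 0 s ⊆ Set.Icc 0 (T t) := Set.Icc_subset_Icc_right hsT
    exact duhamel_unique hS hN (hC s) (h2.mono i1) (h5.mono i2) (fun r hr => h3 r (i1 hr))
      (fun r hr => h6 r (i2 hr)) ⟨hs.1, le_rfl⟩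
  let u : ℝ → Cu := fun t => w t t
  have huw : ∀ t ∈ J, Set.EqOn u (w t) (Set.Icc 0 t) := fun t ht s hs =>
    hglue t ht s (hJs t ht hs) (hs.2.trans (hw t ht).1.le)
  have hu : ContinuousOn u J ∧ ∀ t ∈ J, u t = duhamel S N u₀ u t := by
    refine ⟨fun t ht => ?_, fun t ht => ?_⟩
    · obtain ⟨h1, h2, -⟩ := hw t ht
      have hc : ContinuousWithinAt (w t) (J ∩ Set.Iio (T t)) t :=
        (h2 t ⟨ht.1, h1.le⟩).mono fun s hs => ⟨hs.1.1, hs.2.le⟩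
      have hc' : ContinuousWithinAt u (J ∩ Set.Iio (T t)) t :=
        hc.congr (fun s hs => hglue t ht s hs.1 hs.2.le) rfl
      exact (continuousWithinAt_inter (Iio_mem_nhds h1)).1 hc'
    · have htt : t ∈ Set.Icc 0 t := ⟨ht.1, le_rfl⟩
      rw [duhamel_congr (huw t ht) htt]
      exact (hw t ht).2.2 t ⟨ht.1, (hw t ht).1.le⟩
  refine ⟨u, (isMildSolution_iff hα β γ a b B u₀ hJ0 u).2 hu, fun v hv t ht => ?_,
    fun t ht htT => ?_⟩
  · obtain ⟨hv1, hv2⟩ := (isMildSolution_iff hα β γ a b B u₀ hJ0 v).1 hv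
    exact duhamel_unique hS hN (hC t) (hv1.mono (hJs t ht)) (hu.1.mono (hJs t ht))
      (fun r hr => hv2 r (hJs t ht hr)) (fun r hr => hu.2 r (hJs t ht hr)) ⟨ht.1, le_rfl⟩
  · have htJ : t ∈ J := ⟨ht.le, htT⟩
    refine duhamel_mem_ALambda hα β hγ hN.continuous hNX hX₀ ht (hu.1.mono (hJs t htJ)) ?_
      (hu.2 t htJ)
    exact duhamel_mem hS hN (hC t) ((waveSpace lam).restrictScalars ℝ) (isClosed_waveSpace lam)
      (fun r f hf => heatFlow_mem_waveSpace hα β γ r hf) hNX hX₀ (hu.1.mono (hJs t htJ))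
      (fun r hr => hu.2 r (hJs t htJ hr))

end
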